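/- For a non-abelian group $G$ with centre $Z(G)$, the commuting graph $\Gamma_c(G)$ is the simple graph with vertex set $G\setminus Z(G)$ in which two distinct vertices $x,y$ are adjacent if and only if $xy=yx$. The genus of a finite graph is the smallest non-negative integer $n$ such that the graph can be embedded in the closed orientable surface obtained by attaching $n$ handles to a sphere. (Surfaces and embeddings may be taken to be piecewise linear: the graph embeds in the surface if and only if some triangulation of the surface contains a subdivision of the graph in its $1$-skeleton.) **Theorem.** (1) Let $G$ be a finite non-abelian group whose commuting graph has genus $g$, and let $h=\left\lfloor\frac{7+\sqrt{1+48g}}{2}\right\rfloor$. Then $$|G|<(2h)^{h(4h+1)^2}.$$ (2) Consequently, for every non-negative integer $g$ there are, up to isomorphism, at most finitely many finite non-abelian groups whose commuting graph has genus $g$. -/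

import Mathlib

universe u

/-! ### Closed orientable triangulated surfaces -/

/-- A finite triangulated closed orientable surface with vertex set `W`: a nonempty connected
two-dimensional simplicial complex (given by its triangles) in which every edge lies in exactly two
triangles and the link of every vertex is connected (so that it is a single cycle), and in which
the triangles can be oriented coherently. -/
structure TriangulatedSurface (W : Type*) [Fintype W] [DecidableEq W] where
  /-- the two-dimensional faces -/
  triangles : Finset (Finset W)
  card_triangle : ∀ t ∈ triangles, t.card = 3
  /-- every vertex lies in a triangle -/
  vertex_mem : ∀ w : W, ∃ t ∈ triangles, w ∈ t
  /-- every edge of a triangle lies in exactly two triangles -/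
  edge_mem_two : ∀ t ∈ triangles, ∀ e : Finset W, e ⊆ t → e.card = 2 →
    (triangles.filter fun s => e ⊆ s).card = 2
  /-- the link of `w`, the graph formed by the edges opposite to `w` in the triangles at `w`,
  is connected: any two neighbours `u`, `v` of `w` are joined by a walk in it -/
  link_connected : ∀ w u v : W, u ≠ w → v ≠ w →
    (∃ t ∈ triangles, w ∈ t ∧ u ∈ t) → (∃ t ∈ triangles, w ∈ t ∧ v ∈ t) →
    (SimpleGraph.fromRel fun x y : W => {w, x, y} ∈ triangles).Reachable u v
  /-- the one-skeleton is connected (and nonempty) -/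
  connected : (SimpleGraph.fromRel fun x y : W => ∃ t ∈ triangles, x ∈ t ∧ y ∈ t).Connected
  /-- There is a coherent orientation, `P a b c` meaning that `a → b → c → a` is the positive
  cyclic order of the triangle `{a, b, c}`: exactly one of the two cyclic orders of each triangle is
  positive, and two different triangles induce opposite directions on a common edge. -/
  orientable : ∃ P : W → W → W → Prop,
    (∀ a b c, P a b c → P b c a) ∧
    (∀ a b c, P a b c → a ≠ b ∧ b ≠ c ∧ a ≠ c ∧ {a, b, c} ∈ triangles) ∧
    (∀ a b c, a ≠ b → b ≠ c → a ≠ c → {a, b, c} ∈ triangles → Xor (P a b c) (P b a c)) ∧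
    (∀ a b c d, P a b c → P a b d → c = d)

namespace TriangulatedSurface

variable {W : Type*} [Fintype W] [DecidableEq W]

/-- The one-skeleton of a triangulated surface: its vertices and edges, as a graph. -/
def skeleton (K : TriangulatedSurface W) : SimpleGraph W :=
  SimpleGraph.fromRel fun x y : W => ∃ t ∈ K.triangles, x ∈ t ∧ y ∈ t

/-- The Euler characteristic: vertices minus edges plus triangles. -/
noncomputable def eulerChar (K : TriangulatedSurface W) : ℤ :=
  (Fintype.card W : ℤ) - (K.skeleton.edgeSet.ncard : ℤ) + (K.triangles.card : ℤ)

/-- `K` triangulates the surface obtained by attaching `n` handles to a sphere: by the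
classification of closed surfaces this is the closed connected orientable surface of Euler
characteristic `2 - 2 * n`. -/
def IsSphereWithHandles (K : TriangulatedSurface W) (n : ℕ) : Prop :=
  K.eulerChar = 2 - 2 * (n : ℤ)

end TriangulatedSurface

/-! ### Drawing a graph without crossings, and the genus -/

/-- A drawing of the graph `Γ` without crossings along the graph `Δ`: distinct vertices of `Γ` go to
distinct points, each edge of `Γ` is drawn as a simple arc (a path in `Δ`) between its end vertices,
no arc passes through a vertex of `Γ` other than its ends, and the arcs of two different edges meet
only in vertices of `Γ`. In other words, a subdivision of `Γ` is a subgraph of `Δ`. -/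
structure CrossingFreeDrawing {V W : Type*} (Γ : SimpleGraph V) (Δ : SimpleGraph W) where
  /-- the point that represents a vertex -/
  point : V → W
  point_injective : Function.Injective point
  /-- the arc that represents an edge -/
  arc : ∀ u v : V, Γ.Adj u v → Δ.Walk (point u) (point v)
  arc_isPath : ∀ u v (h : Γ.Adj u v), (arc u v h).IsPath
  /-- the arc does not depend on the direction of the edge -/
  arc_symm : ∀ u v (h : Γ.Adj u v), arc v u h.symm = (arc u v h).reverse
  arc_avoids : ∀ u v (h : Γ.Adj u v) (x : V), point x ∈ (arc u v h).support → x = u ∨ x = v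
  arc_disjoint : ∀ u v (h : Γ.Adj u v) x y (k : Γ.Adj x y), s(u, v) ≠ s(x, y) →
    ∀ w : W, w ∈ (arc u v h).support → w ∈ (arc x y k).support → ∃ z : V, w = point z

/-- The finite graph `Γ` can be embedded in the surface obtained by attaching `n` handles to a
sphere: it can be drawn there without crossings, the vertices and the (piecewise linear) edges
being vertices and edge paths of a sufficiently fine triangulation of the surface. The faces of the
drawing need not be discs. -/
def EmbedsInSphereWithHandles {V : Type*} [Finite V] (Γ : SimpleGraph V) (n : ℕ) : Prop :=
  ∃ (N : ℕ) (K : TriangulatedSurface (Fin N)),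
    K.IsSphereWithHandles n ∧ Nonempty (CrossingFreeDrawing Γ K.skeleton)

/-- The genus of a finite graph: the smallest `n` such that the graph can be embedded in the surface
obtained by attaching `n` handles to a sphere. It is an element of `ℕ∞`, so that no arbitrary
value is involved. -/
noncomputable def graphGenus {V : Type*} [Finite V] (Γ : SimpleGraph V) : ℕ∞ :=
  ⨅ (n : ℕ) (_ : EmbedsInSphereWithHandles Γ n), (n : ℕ∞)

/-! ### The commuting graph -/

/-- The commuting graph of a group: its vertices are the non-central elements, and two distinct
vertices are adjacent if and only if they commute. -/
def commutingGraph (G : Type*) [Group G] : SimpleGraph {x : G // x ∉ Subgroup.center G} where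
  Adj x y := x ≠ y ∧ (x : G) * y = y * x
  symm := ⟨fun _ _ h => ⟨h.1.symm, h.2.symm⟩⟩
  loopless := ⟨fun _ h => h.1 rfl⟩

/-- `heawoodNumber g` is the integer part of `(7 + √(1 + 48 g)) / 2`. -/
noncomputable def heawoodNumber (g : ℕ) : ℕ :=
  ⌊(7 + Real.sqrt (1 + 48 * (g : ℝ))) / 2⌋₊

/-!
Every clique of the commuting graph is small in terms of the genus, hence so is every abelian
subgroup of `G`, and a finite group whose abelian subgroups have order at most `m` has order at most
`m ^ (m * (m + 1))`.

**Cliques.** Let `Γ` be a graph with `v ≥ 1` vertices and `e` edges drawn without crossings in a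
triangulated surface of Euler characteristic `χ`. The regions into which the drawing cuts the
surface are the classes of triangles that can be joined by crossing edges outside the drawing, and
there are at least `χ + e - v` of them (`TriangulatedSurface.eulerChar_le_card_region`). No homology
of surfaces is needed for this: over the field with two elements, the incidence matrix `M` of the
edges off the drawing with the triangles and the incidence matrix `N` of the vertices off the
drawing with those edges satisfy `N * M = 0`, `N` has full rank since the surface is connected, and
the kernel of `M` consists of functions that are constant on regions.

If there are at least two regions, the boundary modulo 2 of a region is a nonempty set of edges of
the drawing without vertices of degree one. Such a set is a union of arcs, and at least three of
them since `Γ` is simple. Every arc borders at most two regions, so that three times the number of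
regions is at most `2 * e`, and Euler's inequality follows
(`TriangulatedSurface.eulerChar_add_ncard_edgeSet_le`). For the complete graph on `n` vertices it
says `(n - 3) * (n - 4) ≤ 12 * g`, that is, `n` is at most the Heawood number `h`.

**Groups.** If `A` is an abelian subgroup and `a` is not central, then `A \ Z(G)` and `a Z(G)` are
cliques, so that `|A| ≤ 2 * h`. A `p`-group has a normal abelian subgroup `A` that is its own
centralizer, and the group modulo `A` embeds into the automorphism group of `A`. This bounds each
Sylow subgroup of `G`; the number of primes dividing `|G|` is bounded because each of them is the
order of a cyclic subgroup.
-/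

/-! ### Triangulated surfaces modulo 2 -/

namespace TriangulatedSurface

variable {W : Type*} [Fintype W] [DecidableEq W] (K : TriangulatedSurface W)

lemma skeleton_adj {x y : W} :
    K.skeleton.Adj x y ↔ x ≠ y ∧ ∃ t ∈ K.triangles, x ∈ t ∧ y ∈ t := by
  simp only [skeleton, SimpleGraph.fromRel_adj]
  grind

lemma skeleton_connected : K.skeleton.Connected := K.connected

lemma exists_two_triangles {e : Sym2 W} (he : e ∈ K.skeleton.edgeSet) :
    ∃ s t : K.triangles, s ≠ t ∧ ∀ r : K.triangles, (∀ x ∈ e, x ∈ r.1) ↔ r = s ∨ r = t := by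
  induction e using Sym2.ind with
  | _ a b =>
    obtain ⟨hab, t₀, ht₀, ha, hb⟩ := K.skeleton_adj.1 he
    have hcard := K.edge_mem_two t₀ ht₀ {a, b}
      (by intro x hx; simp only [Finset.mem_insert, Finset.mem_singleton] at hx; grind)
      (Finset.card_pair hab)
    obtain ⟨s, t, hst, heq⟩ := Finset.card_eq_two.1 hcard
    have hmem : ∀ r, r ∈ K.triangles ∧ {a, b} ⊆ r ↔ r = s ∨ r = t := by
      intro r
      rw [← Finset.mem_filter, heq]
      simp
    refine ⟨⟨s, ((hmem s).2 (Or.inl rfl)).1⟩, ⟨t, ((hmem t).2 (Or.inr rfl)).1⟩,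
      fun h => hst (congrArg Subtype.val h), fun r => ?_⟩
    have := hmem r.1
    simp only [Subtype.ext_iff, ← this, r.2, true_and, Finset.insert_subset_iff,
      Finset.singleton_subset_iff, Sym2.mem_iff, forall_eq_or_imp, forall_eq]

/-- A surface is strongly connected: any two triangles are joined by a chain of triangles in which
consecutive ones share an edge. The links of the vertices give chains around a vertex, and the
connected one-skeleton leads from one vertex to the next. -/
lemma triangle_induction (Q : K.triangles → Prop)
    (hQ : ∀ e ∈ K.skeleton.edgeSet, ∀ s t : K.triangles,
      (∀ x ∈ e, x ∈ s.1) → (∀ x ∈ e, x ∈ t.1) → Q s → Q t)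
    {s₀ : K.triangles} (hs₀ : Q s₀) (t : K.triangles) : Q t := by
  have step : ∀ (x y : W) (s t : K.triangles), x ≠ y → x ∈ s.1 → y ∈ s.1 → x ∈ t.1 → y ∈ t.1 →
      Q s → Q t := by
    intro x y s t hxy hxs hys hxt hyt
    refine hQ s(x, y) (K.skeleton_adj.2 ⟨hxy, s.1, s.2, hxs, hys⟩) s t ?_ ?_ <;>
      simp [*]
  have other : ∀ (w : W) (s : K.triangles), ∃ u ∈ s.1, u ≠ w := by
    intro w s
    obtain ⟨u, hu, huw⟩ := Finset.exists_mem_ne (by rw [K.card_triangle s.1 s.2]; norm_num) w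
    exact ⟨u, hu, huw⟩
  have star : ∀ (w : W) (s t : K.triangles), w ∈ s.1 → w ∈ t.1 → Q s → Q t := by
    intro w s t hws hwt hs
    obtain ⟨u, hus, huw⟩ := other w s
    obtain ⟨v, hvt, hvw⟩ := other w t
    obtain ⟨p⟩ := K.link_connected w u v huw hvw ⟨s.1, s.2, hws, hus⟩ ⟨t.1, t.2, hwt, hvt⟩
    have key : ∀ x y : W, ∀ q : (SimpleGraph.fromRel
        fun x y : W => {w, x, y} ∈ K.triangles).Walk x y, x ≠ w → y ≠ w →
        (∀ r : K.triangles, w ∈ r.1 → x ∈ r.1 → Q r) →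
        ∀ r : K.triangles, w ∈ r.1 → y ∈ r.1 → Q r := by
      intro x y q
      induction q with
      | nil => exact fun _ _ h => h
      | @cons x z y hxz q ih =>
        intro hxw hyw hx
        have hmem : ({w, x, z} : Finset W) ∈ K.triangles := by
          rcases hxz.2 with h | h
          · exact h
          · rwa [show ({w, x, z} : Finset W) = {w, z, x} from by
              rw [Finset.pair_comm x z]]
        have hzw : z ≠ w := by
          rintro rfl
          have h3 := K.card_triangle _ hmem
          rw [Finset.pair_comm x z, Finset.insert_idem] at h3
          exact absurd h3 (by have := Finset.card_le_two (a := z) (b := x); omega)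
        refine ih hzw hyw fun r hwr hzr => ?_
        exact step w z ⟨_, hmem⟩ r hzw.symm (by simp) (by simp) hwr hzr
          (hx ⟨_, hmem⟩ (by simp) (by simp))
    exact key u v p huw hvw (fun r hwr hur => step w u s r huw.symm hws hus hwr hur hs)
      t hwt hvt
  obtain ⟨x, hx⟩ := (Finset.card_pos.1 (by rw [K.card_triangle _ s₀.2]; norm_num) : s₀.1.Nonempty)
  obtain ⟨y, hy⟩ := (Finset.card_pos.1 (by rw [K.card_triangle _ t.2]; norm_num) : t.1.Nonempty)
  obtain ⟨p⟩ := K.skeleton_connected.preconnected x y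
  have key : ∀ x y : W, K.skeleton.Walk x y →
      (∀ r : K.triangles, x ∈ r.1 → Q r) → ∀ r : K.triangles, y ∈ r.1 → Q r := by
    intro x y q
    induction q with
    | nil => exact id
    | cons hxz q ih =>
      intro hx
      obtain ⟨-, t, ht, hxt, hzt⟩ := K.skeleton_adj.1 hxz
      exact ih fun r hzr => star _ ⟨t, ht⟩ r hzt hzr (hx ⟨t, ht⟩ hxt)
  exact key x y p (fun r hr => star x s₀ r hx hr hs₀) t hy

open Classical in
/-- A triangle has two edges at each of its vertices: the reason why the boundary of a boundary
vanishes modulo 2. -/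
lemma card_edges_at (w : W) (t : K.triangles) :
    (Finset.univ.filter fun e : Sym2 W =>
      e ∈ K.skeleton.edgeSet ∧ w ∈ e ∧ ∀ x ∈ e, x ∈ t.1).card = if w ∈ t.1 then 2 else 0 := by
  split_ifs with hw
  · have : (Finset.univ.filter fun e : Sym2 W =>
      e ∈ K.skeleton.edgeSet ∧ w ∈ e ∧ ∀ x ∈ e, x ∈ t.1) = (t.1.erase w).image (s(w, ·)) := by
      ext e
      simp only [Finset.mem_filter, Finset.mem_univ, true_and, Finset.mem_image, Finset.mem_erase]
      constructor
      · rintro ⟨he, hwe, ht⟩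
        obtain ⟨y, rfl⟩ := Sym2.mem_iff_exists.1 hwe
        exact ⟨y, ⟨(K.skeleton_adj.1 he).1.symm, ht y (by simp)⟩, rfl⟩
      · rintro ⟨y, ⟨hy, hyt⟩, rfl⟩
        exact ⟨K.skeleton_adj.2 ⟨hy.symm, t.1, t.2, hw, hyt⟩, by simp, by simp [hw, hyt]⟩
    rw [this, Finset.card_image_of_injective, Finset.card_erase_of_mem hw, K.card_triangle _ t.2]
    intro x y h
    exact Sym2.congr_right.1 h
  · rw [Finset.card_eq_zero, Finset.filter_eq_empty_iff]
    rintro e - ⟨-, hwe, ht⟩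
    exact hw (ht w hwe)

open Classical in
/-- The coefficient at the edge `e` of the boundary of the 2-chain `c` modulo 2. The definition
makes sense for every unordered pair `e`, but is only of interest if `e` is an edge of the surface. -/
noncomputable def boundary (c : K.triangles → ZMod 2) (e : Sym2 W) : ZMod 2 :=
  ∑ t : K.triangles, if ∀ x ∈ e, x ∈ t.1 then c t else 0

lemma boundary_eq_add (c : K.triangles → ZMod 2) {e : Sym2 W} {s t : K.triangles} (hst : s ≠ t)
    (h : ∀ r : K.triangles, (∀ x ∈ e, x ∈ r.1) ↔ r = s ∨ r = t) :
    K.boundary c e = c s + c t := by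
  classical
  rw [boundary, ← Finset.sum_filter, ← Finset.sum_pair hst]
  refine Finset.sum_congr ?_ fun _ _ => rfl
  ext r
  simp [h]

open Classical in
lemma sum_boundary (c : K.triangles → ZMod 2) (w : W) :
    ∑ e : Sym2 W with e ∈ K.skeleton.edgeSet ∧ w ∈ e, K.boundary c e = 0 := by
  simp only [boundary]
  rw [Finset.sum_comm]
  refine Finset.sum_eq_zero fun t _ => ?_
  rw [← Finset.sum_filter, Finset.filter_filter, Finset.sum_const]
  simp only [and_assoc]
  rw [card_edges_at]
  split_ifs
  · rw [two_nsmul, CharTwo.add_self_eq_zero]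
  · rw [zero_nsmul]

/-- The edges in the support of a boundary form a graph without vertices of degree one. -/
lemma exists_ne_boundary_ne_zero (c : K.triangles → ZMod 2) {w : W} {e : Sym2 W}
    (he : e ∈ K.skeleton.edgeSet) (hw : w ∈ e) (hc : K.boundary c e ≠ 0) :
    ∃ e' ∈ K.skeleton.edgeSet, e' ≠ e ∧ w ∈ e' ∧ K.boundary c e' ≠ 0 := by
  classical
  by_contra! h
  have hs := K.sum_boundary c w
  rw [Finset.sum_eq_single_of_mem e (by simp [he, hw]) fun e' he' hne => ?_] at hs
  · exact hc hs
  · simp only [Finset.mem_filter, Finset.mem_univ, true_and] at he'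
    exact h e' he'.1 hne he'.2

/-- Two triangles have a common edge that does not belong to the set `D` of edges. -/
def AdjacentOff (D : Set (Sym2 W)) (s t : K.triangles) : Prop :=
  ∃ e ∈ K.skeleton.edgeSet, e ∉ D ∧ (∀ x ∈ e, x ∈ s.1) ∧ ∀ x ∈ e, x ∈ t.1

/-- The regions into which the set `D` of edges cuts the surface: the classes of the equivalence
relation on triangles generated by `AdjacentOff D`. -/
abbrev Region (D : Set (Sym2 W)) : Type _ := Quot (K.AdjacentOff D)

/-- A subgraph with edge set `D` and vertex set `Z` (which may contain isolated vertices) cuts the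
surface into at least `χ + |D| - |Z|` regions. The subgraph need not be connected. -/
theorem eulerChar_le_card_region {D : Set (Sym2 W)} {Z : Set W} (hD : D ⊆ K.skeleton.edgeSet)
    (hDZ : ∀ e ∈ D, ∀ x ∈ e, x ∈ Z) (hZ : Z.Nonempty) :
    K.eulerChar + D.ncard - Z.ncard ≤ Nat.card (K.Region D) := by
  classical
  let E := {e : Sym2 W // e ∈ K.skeleton.edgeSet ∧ e ∉ D}
  let U := {w : W // w ∉ Z}
  -- `M` is the boundary map from triangles to edges off `D`, `N` the one from these edges to
  -- vertices off `Z`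
  let M : Matrix E K.triangles (ZMod 2) := fun e t => if ∀ x ∈ e.1, x ∈ t.1 then 1 else 0
  let N : Matrix U E (ZMod 2) := fun w e => if w.1 ∈ e.1 then 1 else 0
  have hNM : N * M = 0 := by
    ext w t
    have h2 := K.card_edges_at w.1 t
    have : (Finset.univ.filter fun e : E => w.1 ∈ e.1 ∧ ∀ x ∈ e.1, x ∈ t.1).card =
        (Finset.univ.filter fun e : Sym2 W =>
          e ∈ K.skeleton.edgeSet ∧ w.1 ∈ e ∧ ∀ x ∈ e, x ∈ t.1).card := by
      refine Finset.card_bij (fun e _ => e.1) ?_ (fun a _ b _ h => Subtype.ext h) ?_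
      · intro e he
        simp only [Finset.mem_filter, Finset.mem_univ, true_and] at he ⊢
        exact ⟨e.2.1, he⟩
      · intro e he
        simp only [Finset.mem_filter, Finset.mem_univ, true_and] at he
        exact ⟨⟨e, he.1, fun hed => w.2 (hDZ e hed _ he.2.1)⟩, by simpa using he.2, rfl⟩
    rw [Matrix.mul_apply, Matrix.zero_apply]
    simp only [N, M, ite_mul, one_mul, zero_mul, ← ite_and]
    rw [← Finset.sum_filter, Finset.sum_const, this, h2]
    split_ifs
    · rw [two_nsmul, CharTwo.add_self_eq_zero]
    · rw [zero_nsmul]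
  have hN : N.rank = Fintype.card U := by
    refine LinearIndependent.rank_matrix (Fintype.linearIndependent_iff.2 fun g hg => ?_)
    -- a linear relation between the rows of `N`, extended by zero on `Z`, is constant along edges
    let g' : W → ZMod 2 := fun w => if h : w ∈ Z then 0 else g ⟨w, h⟩
    have hadj : ∀ x y, K.skeleton.Adj x y → g' x = g' y := by
      intro x y hxy
      by_cases hd : s(x, y) ∈ D
      · have hx := hDZ _ hd x (by simp)
        have hy := hDZ _ hd y (by simp)
        simp [g', hx, hy]
      · have h := congrFun hg ⟨s(x, y), hxy, hd⟩
        have hsum : ∑ w : W, (if w ∈ s(x, y) then g' w else 0) = 0 := by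
          rw [Pi.zero_apply, Finset.sum_apply] at h
          rw [← Fintype.sum_subtype_add_sum_subtype (· ∈ Z),
            Finset.sum_eq_zero (fun w _ => by simp [g', w.2]), zero_add]
          refine Eq.trans (Fintype.sum_congr _ _ fun w => ?_) h
          simp [g', w.2, N, Matrix.row]
        rw [← Finset.sum_filter] at hsum
        have : (Finset.univ.filter fun w => w ∈ s(x, y)) = {x, y} := by ext; simp
        rw [this, Finset.sum_pair hxy.ne] at hsum
        exact CharTwo.add_eq_zero.1 hsum
    obtain ⟨z, hz⟩ := hZ
    have hall : ∀ x y, K.skeleton.Walk x y → g' x = g' y := by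
      intro x y p
      induction p with
      | nil => rfl
      | cons h _ ih => exact (hadj _ _ h).trans ih
    intro w
    obtain ⟨p⟩ := K.skeleton_connected.preconnected w.1 z
    have := hall _ _ p
    simpa [g', w.2, hz] using this
  have hrank := Matrix.rank_add_rank_le_card_of_mul_eq_zero hNM
  have hker := LinearMap.finrank_range_add_finrank_ker M.mulVecLin
  have hle : Module.finrank (ZMod 2) (LinearMap.ker M.mulVecLin) ≤ Nat.card (K.Region D) := by
    have : Fintype (K.Region D) := Fintype.ofFinite _
    let L : (K.Region D → ZMod 2) →ₗ[ZMod 2] (K.triangles → ZMod 2) :=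
      LinearMap.funLeft (ZMod 2) (ZMod 2) (Quot.mk _)
    have hsub : LinearMap.ker M.mulVecLin ≤ LinearMap.range L := by
      intro c hc
      have hc' : ∀ s t, K.AdjacentOff D s t → c s = c t := by
        rintro s t ⟨e, he, hed, hs, ht⟩
        obtain ⟨a, b, hab, hr⟩ := K.exists_two_triangles he
        have h0 : K.boundary c e = 0 := by
          have := congrFun (LinearMap.mem_ker.1 hc) ⟨e, he, hed⟩
          refine Eq.trans (Fintype.sum_congr _ (fun t => M ⟨e, he, hed⟩ t * c t) fun t => ?_) this
          simp [M]
        rw [K.boundary_eq_add c hab hr] at h0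
        have h1 := CharTwo.add_eq_zero.1 h0
        rcases (hr s).1 hs with rfl | rfl <;> rcases (hr t).1 ht with rfl | rfl <;>
          simp [h1]
      exact ⟨Quot.lift c hc', rfl⟩
    calc _ ≤ Module.finrank (ZMod 2) (LinearMap.range L) := Submodule.finrank_mono hsub
      _ ≤ Module.finrank (ZMod 2) (K.Region D → ZMod 2) := LinearMap.finrank_range_le L
      _ = _ := by rw [Module.finrank_fintype_fun_eq_card, Nat.card_eq_fintype_card]
  rw [Module.finrank_fintype_fun_eq_card, Fintype.card_coe] at hker
  have hrM : M.rank = Module.finrank (ZMod 2) (LinearMap.range M.mulVecLin) := rfl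
  have hE : Fintype.card E + D.ncard = K.skeleton.edgeSet.ncard := by
    rw [← Set.ncard_sdiff_add_ncard_of_subset hD, ← Nat.card_eq_fintype_card]
    rfl
  have hU : Fintype.card U + Z.ncard = Fintype.card W := by
    rw [← Nat.card_eq_fintype_card, ← Nat.card_eq_fintype_card (α := W), add_comm]
    exact Set.ncard_add_ncard_compl Z
  unfold eulerChar
  omega

end TriangulatedSurface

/-! ### Paths -/

namespace SimpleGraph.Walk

variable {W : Type*} {Δ : SimpleGraph W} {a b : W}

lemma mem_edges_iff_exists_getVert {p : Δ.Walk a b} {e : Sym2 W} :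
    e ∈ p.edges ↔ ∃ i < p.length, e = s(p.getVert i, p.getVert (i + 1)) := by
  rw [List.mem_iff_getElem]
  constructor
  · rintro ⟨i, hi, rfl⟩
    exact ⟨i, by simpa using hi, p.getElem_edges hi⟩
  · rintro ⟨i, hi, rfl⟩
    exact ⟨i, by simpa using hi, p.getElem_edges _⟩

lemma IsPath.getVert_mem_edge_iff {p : Δ.Walk a b} (hp : p.IsPath) {i k : ℕ} (hi : i < p.length)
    (hk : k ≤ p.length) :
    p.getVert k ∈ s(p.getVert i, p.getVert (i + 1)) ↔ k = i ∨ k = i + 1 := by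
  have h1 : ∀ j ≤ p.length, p.getVert k = p.getVert j ↔ k = j := fun j hj =>
    ⟨fun h => hp.getVert_injOn hk hj h, fun h => h ▸ rfl⟩
  rw [Sym2.mem_iff, h1 i hi.le, h1 (i + 1) hi]

/-- If the edges in `B` at an inner vertex of a path never come alone, and are continued within the
path, then `B` contains all edges of the path or none. -/
lemma IsPath.edges_subset_of_forall_exists_ne {p : Δ.Walk a b} (hp : p.IsPath) {B : Set (Sym2 W)}
    (hB : ∀ x ∈ p.support, x ≠ a → x ≠ b → ∀ e ∈ B, x ∈ e →
      ∃ e' ∈ B, e' ≠ e ∧ x ∈ e' ∧ e' ∈ p.edges)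
    {e₀ : Sym2 W} (he₀ : e₀ ∈ p.edges) (he₀B : e₀ ∈ B) : ∀ e ∈ p.edges, e ∈ B := by
  let Q : ℕ → Prop := fun i => s(p.getVert i, p.getVert (i + 1)) ∈ B
  have hQ : ∀ i, i + 1 < p.length → (Q i ↔ Q (i + 1)) := by
    intro i hi
    have hne : ∀ j ≤ p.length, j ≠ i + 1 → p.getVert (i + 1) ≠ p.getVert j := fun j hj hji h =>
      hji (hp.getVert_injOn (x₁ := i + 1) (x₂ := j) hi.le hj h).symm
    have key := hB (p.getVert (i + 1)) (p.getVert_mem_support _)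
      (by simpa using hne 0 (by omega) (by omega))
      (by simpa using hne p.length le_rfl (by omega))
    constructor
    · intro h
      obtain ⟨e', he', hne', hx, hep⟩ := key _ h (by simp)
      obtain ⟨j, hj, rfl⟩ := mem_edges_iff_exists_getVert.1 hep
      rcases (hp.getVert_mem_edge_iff hj hi.le).1 hx with h | h
      · rwa [← h] at he'
      · obtain rfl : i = j := by omega
        exact absurd rfl hne'
    · intro h
      obtain ⟨e', he', hne', hx, hep⟩ := key _ h (by simp)
      obtain ⟨j, hj, rfl⟩ := mem_edges_iff_exists_getVert.1 hep
      rcases (hp.getVert_mem_edge_iff hj hi.le).1 hx with h | h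
      · exact absurd (by rw [h]) hne'
      · obtain rfl : i = j := by omega
        exact he'
  have hall : ∀ i < p.length, Q i ↔ Q 0 := by
    intro i hi
    induction i with
    | zero => rfl
    | succ i ih => exact (hQ i hi).symm.trans (ih (by omega))
  obtain ⟨i, hi, rfl⟩ := mem_edges_iff_exists_getVert.1 he₀
  intro e he
  obtain ⟨j, hj, rfl⟩ := mem_edges_iff_exists_getVert.1 he
  exact (hall j hj).2 ((hall i hi).1 he₀B)

lemma IsPath.eq_of_start_mem {p : Δ.Walk a b} (hp : p.IsPath) {e e' : Sym2 W} (he : e ∈ p.edges)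
    (he' : e' ∈ p.edges) (ha : a ∈ e) (ha' : a ∈ e') : e = e' := by
  have key : ∀ f ∈ p.edges, a ∈ f → f = s(p.getVert 0, p.getVert 1) := by
    intro f hf haf
    obtain ⟨i, hi, rfl⟩ := mem_edges_iff_exists_getVert.1 hf
    have : p.getVert 0 ∈ s(p.getVert i, p.getVert (i + 1)) := by simpa using haf
    rcases (hp.getVert_mem_edge_iff hi (Nat.zero_le _)).1 this with h | h
    · rw [← h]
    · omega
  rw [key e he ha, key e' he' ha']

end SimpleGraph.Walk

/-! ### Drawings without crossings -/

namespace CrossingFreeDrawing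

variable {V V' W : Type*} {Γ : SimpleGraph V} {Γ' : SimpleGraph V'} {Δ : SimpleGraph W}

/-- The drawing of a subgraph, or more generally of the source of an injective homomorphism. -/
def comap (d : CrossingFreeDrawing Γ Δ) (f : Γ' →g Γ) (hf : Function.Injective f) :
    CrossingFreeDrawing Γ' Δ where
  point x := d.point (f x)
  point_injective := d.point_injective.comp hf
  arc u v h := d.arc (f u) (f v) (f.map_adj h)
  arc_isPath u v h := d.arc_isPath _ _ _
  arc_symm u v h := d.arc_symm _ _ _
  arc_avoids u v h x hx := (d.arc_avoids _ _ _ _ hx).imp (fun h => hf h) fun h => hf h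
  arc_disjoint u v h x y k hne w hw hw' := by
    have hne' : s(f u, f v) ≠ s(f x, f y) := fun he =>
      hne (Sym2.map.injective hf (by simpa using he))
    obtain ⟨z, rfl⟩ := d.arc_disjoint _ _ _ _ _ _ hne' w hw hw'
    rcases d.arc_avoids _ _ _ _ hw with rfl | rfl
    exacts [⟨u, rfl⟩, ⟨v, rfl⟩]

variable (d : CrossingFreeDrawing Γ Δ)

/-- The edges of the arc that represents `a`. It is defined for unordered pairs, and empty unless
`a` is an edge of `Γ`. -/
def arcEdges (a : Sym2 V) : Set (Sym2 W) :=
  {e | ∃ (u v : V) (h : Γ.Adj u v), s(u, v) = a ∧ e ∈ (d.arc u v h).edges}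

/-- The vertices of the arc that represents `a`, other than its two ends. -/
def arcInterior (a : Sym2 V) : Set W :=
  {w | ∃ (u v : V) (h : Γ.Adj u v), s(u, v) = a ∧ w ∈ (d.arc u v h).support ∧
    w ≠ d.point u ∧ w ≠ d.point v}

/-- The edges of the subdivision of `Γ` formed by the arcs. -/
def edges : Set (Sym2 W) := ⋃ a : Γ.edgeSet, d.arcEdges a

/-- The vertices of the subdivision of `Γ` formed by the arcs, isolated vertices included. -/
def vertices : Set W := Set.range d.point ∪ ⋃ a : Γ.edgeSet, d.arcInterior a

lemma mem_edges_iff {e : Sym2 W} :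
    e ∈ d.edges ↔ ∃ (u v : V) (h : Γ.Adj u v), e ∈ (d.arc u v h).edges := by
  simp only [edges, Set.mem_iUnion, arcEdges, Set.mem_ofPred_eq]
  constructor
  · rintro ⟨a, u, v, h, -, he⟩
    exact ⟨u, v, h, he⟩
  · rintro ⟨u, v, h, he⟩
    exact ⟨⟨s(u, v), h⟩, u, v, h, rfl, he⟩

lemma mem_arcEdges {u v : V} (h : Γ.Adj u v) {e : Sym2 W} :
    e ∈ d.arcEdges s(u, v) ↔ e ∈ (d.arc u v h).edges := by
  constructor
  · rintro ⟨x, y, k, hxy, he⟩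
    rcases Sym2.eq_iff.1 hxy with ⟨rfl, rfl⟩ | ⟨rfl, rfl⟩
    · exact he
    · rw [d.arc_symm _ _ h] at he
      simpa using he
  · exact fun he => ⟨u, v, h, rfl, he⟩

lemma mem_arcInterior {u v : V} (h : Γ.Adj u v) {w : W} :
    w ∈ d.arcInterior s(u, v) ↔
      w ∈ (d.arc u v h).support ∧ w ≠ d.point u ∧ w ≠ d.point v := by
  constructor
  · rintro ⟨x, y, k, hxy, hw, hx, hy⟩
    rcases Sym2.eq_iff.1 hxy with ⟨rfl, rfl⟩ | ⟨rfl, rfl⟩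
    · exact ⟨hw, hx, hy⟩
    · rw [d.arc_symm _ _ h] at hw
      exact ⟨by simpa using hw, hy, hx⟩
  · exact fun he => ⟨u, v, h, rfl, he⟩

lemma mem_vertices_of_mem_support {u v : V} (h : Γ.Adj u v) {w : W}
    (hw : w ∈ (d.arc u v h).support) : w ∈ d.vertices := by
  by_cases hu : w = d.point u
  · exact Or.inl ⟨u, hu.symm⟩
  by_cases hv : w = d.point v
  · exact Or.inl ⟨v, hv.symm⟩
  exact Or.inr (Set.mem_iUnion.2 ⟨⟨s(u, v), h⟩, (d.mem_arcInterior h).2 ⟨hw, hu, hv⟩⟩)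

lemma mem_vertices_of_mem_edges {e : Sym2 W} (he : e ∈ d.edges) {w : W} (hw : w ∈ e) :
    w ∈ d.vertices := by
  obtain ⟨u, v, h, he⟩ := d.mem_edges_iff.1 he
  exact d.mem_vertices_of_mem_support h (SimpleGraph.Walk.mem_support_of_mem_edges he hw)

lemma edges_subset : d.edges ⊆ Δ.edgeSet := by
  intro e he
  obtain ⟨u, v, h, he⟩ := d.mem_edges_iff.1 he
  exact SimpleGraph.Walk.edges_subset_edgeSet _ he

lemma eq_of_mem_edges {u v x y : V} {h : Γ.Adj u v} {k : Γ.Adj x y} {e : Sym2 W}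
    (he : e ∈ (d.arc u v h).edges) (he' : e ∈ (d.arc x y k).edges) : s(u, v) = s(x, y) := by
  by_contra hne
  have hpt : ∀ w ∈ e, ∃ z, w = d.point z := fun w hw => d.arc_disjoint u v h x y k hne w
    (SimpleGraph.Walk.mem_support_of_mem_edges he hw)
    (SimpleGraph.Walk.mem_support_of_mem_edges he' hw)
  have hadj : e ∈ Δ.edgeSet := SimpleGraph.Walk.edges_subset_edgeSet _ he
  induction e using Sym2.ind with
  | _ p q =>
    obtain ⟨z, rfl⟩ := hpt p (by simp)
    obtain ⟨z', rfl⟩ := hpt q (by simp)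
    have hzz : z ≠ z' := fun hz => (SimpleGraph.mem_edgeSet _ |>.1 hadj).ne (hz ▸ rfl)
    have h1 := d.arc_avoids u v h z (SimpleGraph.Walk.mem_support_of_mem_edges he (by simp))
    have h2 := d.arc_avoids u v h z' (SimpleGraph.Walk.mem_support_of_mem_edges he (by simp))
    have h3 := d.arc_avoids x y k z (SimpleGraph.Walk.mem_support_of_mem_edges he' (by simp))
    have h4 := d.arc_avoids x y k z' (SimpleGraph.Walk.mem_support_of_mem_edges he' (by simp))
    apply hne
    rw [Sym2.eq_iff]
    grind

lemma arcEdges_disjoint {a b : Sym2 V} (hab : a ≠ b) :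
    Disjoint (d.arcEdges a) (d.arcEdges b) := by
  rw [Set.disjoint_left]
  rintro e ⟨u, v, h, rfl, he⟩ ⟨x, y, k, rfl, he'⟩
  exact hab (d.eq_of_mem_edges he he')

lemma ncard_arcInterior_add_one_le {a : Sym2 V} (ha : a ∈ Γ.edgeSet) :
    (d.arcInterior a).ncard + 1 ≤ (d.arcEdges a).ncard := by
  classical
  induction a using Sym2.ind with
  | _ u v =>
    have h : Γ.Adj u v := ha
    have hp := d.arc_isPath u v h
    have hE : d.arcEdges s(u, v) = ((d.arc u v h).edges.toFinset : Set (Sym2 W)) := by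
      ext e
      simp [d.mem_arcEdges h]
    have hI : d.arcInterior s(u, v) =
        ((((d.arc u v h).support.toFinset.erase (d.point u)).erase (d.point v) : Finset W) :
          Set W) := by
      ext w
      simp only [d.mem_arcInterior h, Finset.coe_erase, Set.mem_sdiff, List.coe_toFinset,
        Set.mem_ofPred_eq, Set.mem_singleton_iff]
      tauto
    have huv : d.point v ≠ d.point u := fun hvu => h.ne (d.point_injective hvu).symm
    have hpos : 0 < (d.arc u v h).length := by
      rw [Nat.pos_iff_ne_zero]
      exact fun h0 => huv (SimpleGraph.Walk.eq_of_length_eq_zero h0).symm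
    rw [hE, hI, Set.ncard_coe_finset, Set.ncard_coe_finset,
      List.toFinset_card_of_nodup hp.isTrail.edges_nodup,
      Finset.card_erase_of_mem (by simp [huv]), Finset.card_erase_of_mem (by simp),
      List.toFinset_card_of_nodup hp.support_nodup, SimpleGraph.Walk.length_support,
      SimpleGraph.Walk.length_edges]
    omega

/-- Subdividing edges does not increase the number of vertices minus the number of edges. -/
lemma ncard_vertices_add_le [Finite V] [Finite W] :
    d.vertices.ncard + Γ.edgeSet.ncard ≤ Nat.card V + d.edges.ncard := by
  classical
  have := Fintype.ofFinite V
  have := Fintype.ofFinite W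
  have hE : d.edges.ncard = ∑ a : Γ.edgeSet, (d.arcEdges a).ncard := by
    have : d.edges = ((Finset.univ.biUnion fun a : Γ.edgeSet =>
        (d.arcEdges a).toFinite.toFinset : Finset (Sym2 W)) : Set (Sym2 W)) := by
      ext; simp [edges]
    rw [this, Set.ncard_coe_finset, Finset.card_biUnion]
    · exact Finset.sum_congr rfl fun a _ => (Set.ncard_eq_toFinset_card _ _).symm
    · intro a _ b _ hab
      refine Set.Finite.disjoint_toFinset.2 ?_
      exact d.arcEdges_disjoint fun h => hab (Subtype.ext h)
  have hI : (⋃ a : Γ.edgeSet, d.arcInterior a).ncard ≤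
      ∑ a : Γ.edgeSet, (d.arcInterior a).ncard := by
    have : (⋃ a : Γ.edgeSet, d.arcInterior a) = ((Finset.univ.biUnion fun a : Γ.edgeSet =>
        (d.arcInterior a).toFinite.toFinset : Finset W) : Set W) := by
      ext; simp
    rw [this, Set.ncard_coe_finset]
    refine Finset.card_biUnion_le.trans (Finset.sum_le_sum fun a _ => ?_)
    rw [← Set.ncard_eq_toFinset_card]
  have hV : d.vertices.ncard ≤ Nat.card V + ∑ a : Γ.edgeSet, (d.arcInterior a).ncard := by
    refine (Set.ncard_union_le _ _).trans (add_le_add ?_ hI)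
    rw [← Set.image_univ, ← Set.ncard_univ]
    exact Set.ncard_image_le
  have hsum : ∑ a : Γ.edgeSet, (d.arcInterior a).ncard + Γ.edgeSet.ncard ≤
      ∑ a : Γ.edgeSet, (d.arcEdges a).ncard := by
    have : Γ.edgeSet.ncard = ∑ a : Γ.edgeSet, 1 := by
      rw [← Nat.card_coe_set_eq, Nat.card_eq_fintype_card]
      simp
    rw [this, ← Finset.sum_add_distrib]
    exact Finset.sum_le_sum fun a _ => d.ncard_arcInterior_add_one_le a.2
  omega

section Leafless

variable {d} {B : Set (Sym2 W)}

/-- A subgraph of the drawing without vertices of degree one is a union of arcs, because the drawing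
has only two edges at an inner vertex of an arc. -/
lemma edges_subset_of_leafless (hBd : B ⊆ d.edges)
    (hB : ∀ w, ∀ e ∈ B, w ∈ e → ∃ e' ∈ B, e' ≠ e ∧ w ∈ e')
    {u v : V} {h : Γ.Adj u v} {e : Sym2 W} (he : e ∈ (d.arc u v h).edges)
    (heB : e ∈ B) : ∀ f ∈ (d.arc u v h).edges, f ∈ B := by
  refine (d.arc_isPath u v h).edges_subset_of_forall_exists_ne ?_ he heB
  intro x hx hxu hxv f hf hxf
  obtain ⟨f', hf', hne, hxf'⟩ := hB x f hf hxf
  refine ⟨f', hf', hne, hxf', ?_⟩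
  obtain ⟨y, z, k, hyz⟩ := d.mem_edges_iff.1 (hBd hf')
  have hs : s(u, v) = s(y, z) := by
    by_contra hne'
    obtain ⟨t, rfl⟩ := d.arc_disjoint u v h y z k hne' x hx
      (SimpleGraph.Walk.mem_support_of_mem_edges hyz hxf')
    rcases d.arc_avoids u v h t hx with rfl | rfl
    exacts [hxu rfl, hxv rfl]
  rw [← d.mem_arcEdges h, hs, d.mem_arcEdges k]
  exact hyz

lemma exists_adj_ne_of_leafless (hBd : B ⊆ d.edges)
    (hB : ∀ w, ∀ e ∈ B, w ∈ e → ∃ e' ∈ B, e' ≠ e ∧ w ∈ e')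
    {u v : V} {h : Γ.Adj u v} {e : Sym2 W}
    (he : e ∈ (d.arc u v h).edges) (heB : e ∈ B) :
    ∃ (w : V) (k : Γ.Adj u w), w ≠ v ∧ ∃ f ∈ (d.arc u w k).edges, f ∈ B := by
  have hpos : 0 < (d.arc u v h).length := by
    rw [← SimpleGraph.Walk.length_edges]
    exact List.length_pos_of_mem he
  have h0 : s((d.arc u v h).getVert 0, (d.arc u v h).getVert 1) ∈ (d.arc u v h).edges :=
    SimpleGraph.Walk.mem_edges_iff_exists_getVert.2 ⟨0, hpos, rfl⟩
  have hu0 : d.point u ∈ s((d.arc u v h).getVert 0, (d.arc u v h).getVert 1) := by simp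
  obtain ⟨f, hf, hne, huf⟩ := hB (d.point u) _ (edges_subset_of_leafless hBd hB he heB _ h0) hu0
  have hw : ∃ (w : V) (k : Γ.Adj u w), f ∈ (d.arc u w k).edges := by
    obtain ⟨y, z, k, hyz⟩ := d.mem_edges_iff.1 (hBd hf)
    rcases d.arc_avoids y z k u (SimpleGraph.Walk.mem_support_of_mem_edges hyz huf) with rfl | rfl
    · exact ⟨z, k, hyz⟩
    · refine ⟨y, k.symm, ?_⟩
      rw [d.arc_symm _ _ k]
      simpa using hyz
  obtain ⟨w, k, hfw⟩ := hw
  refine ⟨w, k, ?_, f, hfw, hf⟩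
  rintro rfl
  exact hne ((d.arc_isPath u w h).eq_of_start_mem hfw h0 huf hu0)

/-- A nonempty subgraph of the drawing without vertices of degree one has at least three arcs:
an arc, and one more arc at each of its two ends. -/
lemma three_le_ncard_of_leafless [Finite V] (hBd : B ⊆ d.edges)
    (hB : ∀ w, ∀ e ∈ B, w ∈ e → ∃ e' ∈ B, e' ≠ e ∧ w ∈ e')
    (hne : B.Nonempty) :
    3 ≤ {a : Γ.edgeSet | d.arcEdges a ⊆ B}.ncard := by
  obtain ⟨e, he⟩ := hne
  obtain ⟨u, v, h, heuv⟩ := d.mem_edges_iff.1 (hBd he)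
  obtain ⟨w, hw, hwv, f, hf, hfB⟩ := exists_adj_ne_of_leafless hBd hB heuv he
  have heuv' : e ∈ (d.arc v u h.symm).edges := by
    rw [d.arc_symm _ _ h]
    simpa using heuv
  obtain ⟨x, hx, hxu, k, hk, hkB⟩ := exists_adj_ne_of_leafless hBd hB heuv' he
  have hmem : ∀ {y z : V} (l : Γ.Adj y z) {g : Sym2 W}, g ∈ (d.arc y z l).edges → g ∈ B →
      d.arcEdges s(y, z) ⊆ B := fun l _ hg hgB i hi =>
    edges_subset_of_leafless hBd hB hg hgB i ((d.mem_arcEdges l).1 hi)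
  let a : Γ.edgeSet := ⟨s(u, v), h⟩
  let b : Γ.edgeSet := ⟨s(u, w), hw⟩
  let c : Γ.edgeSet := ⟨s(v, x), hx⟩
  have hab : a ≠ b := fun hh => hwv (Sym2.congr_right.1 (congrArg Subtype.val hh)).symm
  have hac : a ≠ c := by
    intro hh
    have : s(v, u) = s(v, x) := Sym2.eq_swap.trans (congrArg Subtype.val hh)
    exact hxu (Sym2.congr_right.1 this).symm
  have hbc : b ≠ c := by
    intro hh
    rcases Sym2.eq_iff.1 (congrArg Subtype.val hh) with ⟨h1, -⟩ | ⟨h1, -⟩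
    exacts [h.ne h1, hxu h1.symm]
  have hsub : ({a, b, c} : Set Γ.edgeSet) ⊆ {a : Γ.edgeSet | d.arcEdges a ⊆ B} := by
    rintro i (rfl | rfl | rfl)
    exacts [hmem h heuv he, hmem hw hf hfB, hmem hx hk hkB]
  rw [← Set.ncard_eq_three.2 ⟨a, b, c, hab, hac, hbc, rfl⟩]
  exact Set.ncard_le_ncard hsub

end Leafless

end CrossingFreeDrawing

/-! ### Euler's inequality and the Heawood bound for cliques -/

namespace TriangulatedSurface

variable {W : Type*} [Fintype W] [DecidableEq W] (K : TriangulatedSurface W)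

/-- Euler's inequality for a graph drawn on a surface, with `F` the number of regions. A graph with
a single region (a tree, for instance) may have fewer edges than the second bound asks for. -/
theorem eulerChar_add_ncard_edgeSet_le {V : Type*} [Finite V] [Nonempty V] {Γ : SimpleGraph V}
    (d : CrossingFreeDrawing Γ K.skeleton) :
    ∃ F : ℕ, K.eulerChar + Γ.edgeSet.ncard ≤ Nat.card V + F ∧
      (F ≤ 1 ∨ 3 * F ≤ 2 * Γ.edgeSet.ncard) := by
  classical
  have := Fintype.ofFinite V
  have : Fintype (K.Region d.edges) := Fintype.ofFinite _
  refine ⟨Nat.card (K.Region d.edges), ?_, ?_⟩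
  · have h1 := K.eulerChar_le_card_region d.edges_subset
      (fun e he x hx => d.mem_vertices_of_mem_edges he hx)
      ⟨d.point (Classical.arbitrary V), Or.inl ⟨_, rfl⟩⟩
    have h2 := d.ncard_vertices_add_le
    omega
  rw [or_iff_not_imp_left]
  intro hF
  let c : K.Region d.edges → K.triangles → ZMod 2 := fun C t => if Quot.mk _ t = C then 1 else 0
  -- the edges on the boundary of the region `C`
  let B : K.Region d.edges → Set (Sym2 W) := fun C =>
    {e | e ∈ K.skeleton.edgeSet ∧ K.boundary (c C) e ≠ 0}
  have hBd : ∀ C, B C ⊆ d.edges := by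
    rintro C e ⟨he, hne⟩
    by_contra hed
    obtain ⟨s, t, hst, hr⟩ := K.exists_two_triangles he
    have hmk : (Quot.mk _ s : K.Region d.edges) = Quot.mk _ t :=
      Quot.sound ⟨e, he, hed, (hr s).2 (Or.inl rfl), (hr t).2 (Or.inr rfl)⟩
    rw [K.boundary_eq_add _ hst hr] at hne
    simp only [c, hmk, CharTwo.add_self_eq_zero, ne_eq, not_true] at hne
  have hB : ∀ C, ∀ w, ∀ e ∈ B C, w ∈ e → ∃ e' ∈ B C, e' ≠ e ∧ w ∈ e' := by
    rintro C w e ⟨he, hne⟩ hw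
    obtain ⟨e', he', hee, hw', hne'⟩ := K.exists_ne_boundary_ne_zero (c C) he hw hne
    exact ⟨e', ⟨he', hne'⟩, hee, hw'⟩
  have hBne : ∀ C, (B C).Nonempty := by
    intro C
    by_contra hempty
    rw [Set.not_nonempty_iff_eq_empty, Set.eq_empty_iff_forall_notMem] at hempty
    obtain ⟨s₀, hs₀⟩ := Quot.exists_rep C
    -- otherwise `C` contains with a triangle all its neighbours, and is the only region
    have hall := K.triangle_induction (fun t => (Quot.mk _ t : K.Region d.edges) = C) (by
      intro e he s t hs ht hsC
      obtain ⟨a, b, hab, hr⟩ := K.exists_two_triangles he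
      have h0 : K.boundary (c C) e = 0 := by
        by_contra hne
        exact hempty e ⟨he, hne⟩
      rw [K.boundary_eq_add _ hab hr] at h0
      have h1 : c C s = c C t := by
        have h1 := CharTwo.add_eq_zero.1 h0
        rcases (hr s).1 hs with rfl | rfl <;> rcases (hr t).1 ht with rfl | rfl <;>
          simp [h1]
      by_contra htC
      simp [c, hsC, htC] at h1) hs₀
    refine hF (Finite.card_le_one_iff_subsingleton.2 ⟨fun C₁ C₂ => ?_⟩)
    obtain ⟨s, rfl⟩ := Quot.exists_rep C₁
    obtain ⟨t, rfl⟩ := Quot.exists_rep C₂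
    rw [hall s, hall t]
  -- double counting of the pairs of a region and an arc on its boundary
  have hthree : ∀ C, 3 ≤ (Finset.univ.filter fun a : Γ.edgeSet => d.arcEdges a ⊆ B C).card := by
    intro C
    have := CrossingFreeDrawing.three_le_ncard_of_leafless (hBd C) (hB C) (hBne C)
    rwa [Set.ncard_eq_toFinset_card', Set.toFinset_ofPred] at this
  have htwo : ∀ a : Γ.edgeSet,
      (Finset.univ.filter fun C : K.Region d.edges => d.arcEdges a ⊆ B C).card ≤ 2 := by
    intro a
    have hpos := d.ncard_arcInterior_add_one_le a.2
    obtain ⟨e, he⟩ := Set.nonempty_of_ncard_ne_zero (s := d.arcEdges a) (by omega)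
    have hed : e ∈ d.edges := Set.mem_iUnion.2 ⟨a, he⟩
    obtain ⟨s, t, hst, hr⟩ := K.exists_two_triangles (d.edges_subset hed)
    refine (Finset.card_le_card (t := {Quot.mk _ s, Quot.mk _ t}) fun C hC => ?_).trans
      Finset.card_le_two
    have hne := ((Finset.mem_filter.1 hC).2 he).2
    rw [K.boundary_eq_add _ hst hr] at hne
    by_contra hCst
    simp only [Finset.mem_insert, Finset.mem_singleton, not_or] at hCst
    exact hne (by simp [c, Ne.symm hCst.1, Ne.symm hCst.2])
  have hcount := Finset.sum_card_bipartiteAbove_eq_sum_card_bipartiteBelow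
    (s := (Finset.univ : Finset (K.Region d.edges))) (t := (Finset.univ : Finset Γ.edgeSet))
    (fun C (a : Γ.edgeSet) => d.arcEdges a ⊆ B C)
  have h3 := Finset.card_nsmul_le_sum (Finset.univ : Finset (K.Region d.edges)) _ 3
    fun C _ => hthree C
  have h2 := Finset.sum_le_card_nsmul (Finset.univ : Finset Γ.edgeSet) _ 2 fun a _ => htwo a
  have he : Fintype.card Γ.edgeSet = Γ.edgeSet.ncard := by
    rw [← Nat.card_coe_set_eq, Nat.card_eq_fintype_card]
  simp only [Finset.bipartiteAbove, Finset.bipartiteBelow] at hcount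
  simp only [smul_eq_mul, Finset.card_univ, he] at h2 h3
  rw [Nat.card_eq_fintype_card]
  omega

end TriangulatedSurface

theorem EmbedsInSphereWithHandles.clique_bound {V : Type*} [Finite V] {Γ : SimpleGraph V} {m n : ℕ}
    (h : EmbedsInSphereWithHandles Γ m) (f : (⊤ : SimpleGraph (Fin n)) →g Γ)
    (hf : Function.Injective f) (hn : 3 ≤ n) : ((n : ℤ) - 3) * (n - 4) ≤ 12 * m := by
  classical
  obtain ⟨N, K, hK, ⟨d⟩⟩ := h
  have : Nonempty (Fin n) := ⟨⟨0, by omega⟩⟩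
  obtain ⟨F, h1, h2⟩ := K.eulerChar_add_ncard_edgeSet_le (d.comap f hf)
  have hE : (⊤ : SimpleGraph (Fin n)).edgeSet.ncard = n.choose 2 := by
    rw [← SimpleGraph.coe_edgeFinset, Set.ncard_coe_finset,
      SimpleGraph.card_edgeFinset_top_eq_card_choose_two, Fintype.card_fin]
  rw [hE, Nat.card_eq_fintype_card, Fintype.card_fin, hK] at h1
  rw [hE] at h2
  have h3 : 2 * ((n.choose 2 : ℕ) : ℤ) = n * (n - 1) := by
    have := Nat.choose_two_right n
    have h4 : 2 * n.choose 2 = n * (n - 1) := by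
      rw [this]
      exact Nat.mul_div_cancel' (Nat.even_mul_pred_self n).two_dvd
    zify [show 1 ≤ n by omega] at h4
    exact h4
  have hn' : (3 : ℤ) ≤ n := by exact_mod_cast hn
  rcases h2 with h2 | h2 <;> zify at h2 <;> nlinarith

theorem exists_embedsInSphereWithHandles_le {V : Type*} [Finite V] {Γ : SimpleGraph V} {g : ℕ}
    (h : graphGenus Γ = g) : ∃ m ≤ g, EmbedsInSphereWithHandles Γ m := by
  have hlt : graphGenus Γ < ((g + 1 : ℕ) : ℕ∞) := by
    rw [h]
    exact_mod_cast Nat.lt_succ_self g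
  rw [graphGenus, iInf_lt_iff] at hlt
  obtain ⟨m, hm⟩ := hlt
  rw [iInf_lt_iff] at hm
  obtain ⟨hm, hlt⟩ := hm
  exact ⟨m, Nat.lt_succ_iff.1 (by exact_mod_cast hlt), hm⟩

theorem four_le_heawoodNumber (g : ℕ) : 4 ≤ heawoodNumber g := by
  refine Nat.le_floor ?_
  have : 1 ≤ Real.sqrt (1 + 48 * (g : ℝ)) :=
    Real.one_le_sqrt.2 (by have := Nat.cast_nonneg (α := ℝ) g; linarith)
  push_cast
  linarith

theorem le_heawoodNumber_of_graphGenus_eq {V : Type*} [Finite V] {Γ : SimpleGraph V} {g n : ℕ}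
    (h : graphGenus Γ = g) (f : (⊤ : SimpleGraph (Fin n)) →g Γ) (hf : Function.Injective f) :
    n ≤ heawoodNumber g := by
  rcases Nat.lt_or_ge n 4 with hn | hn
  · exact hn.le.trans (four_le_heawoodNumber g)
  obtain ⟨m, hm, he⟩ := exists_embedsInSphereWithHandles_le h
  have hb := he.clique_bound f hf (by omega)
  have hb' : ((n : ℝ) - 3) * (n - 4) ≤ 12 * m := by exact_mod_cast hb
  have hm' : (m : ℝ) ≤ g := by exact_mod_cast hm
  have hn' : (4 : ℝ) ≤ n := by exact_mod_cast hn
  refine Nat.le_floor ?_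
  have : 2 * (n : ℝ) - 7 ≤ Real.sqrt (1 + 48 * (g : ℝ)) := Real.le_sqrt_of_sq_le (by nlinarith)
  linarith

/-! ### Groups with small abelian subgroups -/

section Groups

variable {G : Type*} [Group G]

theorem ncard_le_heawoodNumber [Finite G] {g : ℕ} (hg : graphGenus (commutingGraph G) = g)
    {S : Set G} (hS : ∀ x ∈ S, x ∉ Subgroup.center G) (hcomm : ∀ x ∈ S, ∀ y ∈ S, x * y = y * x) :
    S.ncard ≤ heawoodNumber g := by
  let e : Fin S.ncard ≃ S := (Finite.equivFinOfCardEq (Nat.card_coe_set_eq S)).symm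
  have he : Function.Injective fun i =>
      (⟨(e i).1, hS _ (e i).2⟩ : {x : G // x ∉ Subgroup.center G}) :=
    fun i j hij => e.injective (Subtype.ext (Subtype.mk.inj hij))
  refine le_heawoodNumber_of_graphGenus_eq hg
    ⟨fun i => ⟨(e i).1, hS _ (e i).2⟩, fun {i j} hij => ⟨fun h => hij (he h), ?_⟩⟩ he
  exact hcomm _ (e i).2 _ (e j).2

theorem card_le_two_mul_heawoodNumber [Finite G] {g : ℕ} (hG : ∃ a b : G, a * b ≠ b * a)
    (hg : graphGenus (commutingGraph G) = g) (A : Subgroup G)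
    (hA : ∀ x ∈ A, ∀ y ∈ A, x * y = y * x) :
    Nat.card A ≤ 2 * heawoodNumber g := by
  obtain ⟨a, b, hab⟩ := hG
  have ha : a ∉ Subgroup.center G := fun h => hab (Subgroup.mem_center_iff.1 h b).symm
  have h1 : ((A : Set G) \ Subgroup.center G).ncard ≤ heawoodNumber g :=
    ncard_le_heawoodNumber hg (fun x hx => hx.2) fun x hx y hy => hA x hx.1 y hy.1
  have h2 : ((a * ·) '' (Subgroup.center G : Set G)).ncard ≤ heawoodNumber g := by
    refine ncard_le_heawoodNumber hg ?_ ?_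
    · rintro _ ⟨z, hz, rfl⟩ h
      exact ha ((Subgroup.mul_mem_cancel_right _ hz).1 h)
    · rintro _ ⟨z, hz, rfl⟩ _ ⟨w, hw, rfl⟩
      have hz' : ∀ x, Commute x z := Subgroup.mem_center_iff.1 hz
      have hw' : ∀ x, Commute x w := Subgroup.mem_center_iff.1 hw
      exact ((Commute.refl a).mul_right (hw' a)).mul_left ((hz' _).symm)
  rw [Set.ncard_image_of_injective _ (mul_right_injective a)] at h2
  have h3 : (A : Set G).ncard ≤ ((A : Set G) \ Subgroup.center G).ncard +
      (Subgroup.center G : Set G).ncard := Set.ncard_le_ncard_sdiff_add_ncard _ _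
  rw [← Nat.card_coe_set_eq] at h3
  change Nat.card A ≤ _ at h3
  omega

/-- A maximal normal abelian subgroup `A` of a finite `p`-group is its own centralizer: otherwise
the centralizer modulo `A` contains a nontrivial central element `y A` of the quotient, and `A` and `y`
generate a larger normal abelian subgroup. -/
theorem IsPGroup.exists_normal_centralizer_eq [Finite G] {p : ℕ} [Fact p.Prime]
    (hG : IsPGroup p G) :
    ∃ A : Subgroup G, A.Normal ∧ Subgroup.centralizer (A : Set G) = A := by
  classical
  let P : Subgroup G → Prop := fun A => A.Normal ∧ A ≤ Subgroup.centralizer (A : Set G)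
  obtain ⟨A, hA⟩ := (Set.toFinite {A | P A}).exists_maximal
    ⟨⊥, (inferInstance : (⊥ : Subgroup G).Normal), bot_le⟩
  have hAn : A.Normal := hA.prop.1
  refine ⟨A, hAn, le_antisymm ?_ hA.prop.2⟩
  by_contra hlt
  -- the image of the centralizer in the quotient by `A` is acted on by conjugation, and the number
  -- of fixed points is divisible by `p`
  let C := Subgroup.centralizer (A : Set G)
  let N : Subgroup (G ⧸ A) := C.map (QuotientGroup.mk' A)
  have hCn : C.Normal := inferInstance
  have hN : N.Normal := hCn.map _ (QuotientGroup.mk'_surjective A)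
  have hQ : IsPGroup p (ConjAct (G ⧸ A)) := hG.to_quotient A
  have hNp : IsPGroup p N := (hG.to_quotient A).to_subgroup N
  obtain ⟨x, hxC, hxA⟩ := Set.not_subset.1 hlt
  have hNnt : Nontrivial N := by
    refine ⟨⟨⟨QuotientGroup.mk' A x, ⟨x, hxC, rfl⟩⟩, 1, fun h => hxA ?_⟩⟩
    exact (QuotientGroup.eq_one_iff x).1 (congrArg Subtype.val h)
  have hdvd : p ∣ Nat.card N := hNp.card_eq_or_dvd.resolve_left (by
    have := Finite.one_lt_card (α := N); omega)
  obtain ⟨b, hb, hb1⟩ := hQ.exists_fixed_point_of_prime_dvd_card_of_fixed_point N hdvd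
    (a := 1) (fun g => smul_one g)
  obtain ⟨y, hyC, hy⟩ := b.2
  have hyA : y ∉ A := fun h => hb1 (Subtype.ext (by
    rw [← hy]; exact ((QuotientGroup.eq_one_iff y).2 h).symm))
  have hconj : ∀ g : G, g * y * g⁻¹ * y⁻¹ ∈ A := by
    intro g
    have h1 := congrArg Subtype.val (hb (ConjAct.toConjAct (QuotientGroup.mk' A g)))
    rw [ConjAct.Subgroup.val_conj_smul, ← hy, ConjAct.toConjAct_smul] at h1
    rw [← QuotientGroup.eq_one_iff]
    change QuotientGroup.mk' A _ = 1
    rw [map_mul, map_mul, map_mul, map_inv, map_inv, h1, mul_inv_cancel]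
  have hyc : ∀ a ∈ A, a * y = y * a := fun a ha => Subgroup.mem_centralizer_iff.1 hyC a ha
  have hPA : P (A ⊔ Subgroup.zpowers y) := by
    constructor
    · constructor
      intro n hn g
      obtain ⟨a, ha, z, ⟨k, rfl⟩, rfl⟩ := Subgroup.mem_sup_of_normal_left.1 hn
      have hg1 : g * y * g⁻¹ ∈ A ⊔ Subgroup.zpowers y := by
        have := Subgroup.mul_mem_sup (hconj g) (Subgroup.mem_zpowers y)
        simpa using this
      have hg2 : g * a * g⁻¹ ∈ A ⊔ Subgroup.zpowers y :=
        Subgroup.mem_sup_left (hAn.conj_mem a ha g)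
      have : g * (a * y ^ k) * g⁻¹ = (g * a * g⁻¹) * (g * y * g⁻¹) ^ k := by
        rw [conj_zpow]; group
      change g * (a * y ^ k) * g⁻¹ ∈ _
      rw [this]
      exact mul_mem hg2 (zpow_mem hg1 k)
    · have hyy : y ∈ Subgroup.centralizer ((A ⊔ Subgroup.zpowers y : Subgroup G) : Set G) := by
        rw [Subgroup.mem_centralizer_iff]
        intro h hh
        obtain ⟨a, ha, z, ⟨k, rfl⟩, rfl⟩ := Subgroup.mem_sup_of_normal_left.1 hh
        have h1 : Commute a y := hyc a ha
        exact h1.mul_left ((Commute.refl y).zpow_left k)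
      refine sup_le (fun a ha => ?_) (Subgroup.zpowers_le.2 hyy)
      rw [Subgroup.mem_centralizer_iff]
      intro h hh
      obtain ⟨a', ha', z, ⟨k, rfl⟩, rfl⟩ := Subgroup.mem_sup_of_normal_left.1 hh
      have h1 : Commute y a := (hyc a ha).symm
      have h2 : Commute a' a := Subgroup.mem_centralizer_iff.1 (hA.prop.2 ha) a' ha'
      exact h2.mul_left (h1.zpow_left k)
  exact hyA (hA.le_of_ge hPA le_sup_left (Subgroup.mem_sup_right (Subgroup.mem_zpowers y)))

/-- The kernel of the action by conjugation on a self-centralizing normal subgroup `A` is contained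
in `A`, and `A` has at most `|A| ^ |A|` automorphisms. -/
theorem IsPGroup.card_le_pow [Finite G] {p m : ℕ} [Fact p.Prime] (hG : IsPGroup p G)
    (hm : ∀ A : Subgroup G, (∀ x ∈ A, ∀ y ∈ A, x * y = y * x) → Nat.card A ≤ m) :
    Nat.card G ≤ m ^ (m + 1) := by
  obtain ⟨A, hAn, hAc⟩ := hG.exists_normal_centralizer_eq
  have hAm : Nat.card A ≤ m := hm A fun x hx y hy => by
    rw [← hAc] at hy
    exact Subgroup.mem_centralizer_iff.1 hy x hx
  let φ : G →* MulAut A := MulAut.conjNormal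
  have hker : φ.ker ≤ A := by
    intro g hg
    rw [← hAc, Subgroup.mem_centralizer_iff]
    intro h hh
    have h1 := congrArg Subtype.val (DFunLike.congr_fun (MonoidHom.mem_ker.1 hg) ⟨h, hh⟩)
    rw [MulAut.conjNormal_apply] at h1
    exact (mul_inv_eq_iff_eq_mul.1 h1).symm
  have hAut : Nat.card (MulAut A) ≤ Nat.card A ^ Nat.card A := by
    rw [← Nat.card_fun]
    exact Nat.card_le_card_of_injective (fun f : MulAut A => (f : A → A)) DFunLike.coe_injective
  have hApos : 0 < m := Nat.card_pos.trans_le hAm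
  calc Nat.card G = Nat.card φ.ker * Nat.card φ.range := by
        rw [← Subgroup.index_ker, Subgroup.card_mul_index]
    _ ≤ Nat.card A * Nat.card (MulAut A) :=
        Nat.mul_le_mul (Subgroup.card_le_of_le hker) (Subgroup.card_le_card_group _)
    _ ≤ m * m ^ m := Nat.mul_le_mul hAm
        (hAut.trans ((Nat.pow_le_pow_left hAm _).trans (Nat.pow_le_pow_right hApos hAm)))
    _ = m ^ (m + 1) := by ring

theorem card_le_pow_of_card_commutative_le [Finite G] {m : ℕ}
    (hm : ∀ A : Subgroup G, (∀ x ∈ A, ∀ y ∈ A, x * y = y * x) → Nat.card A ≤ m) :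
    Nat.card G ≤ (m ^ (m + 1)) ^ m := by
  have hmpos : 0 < m := Nat.card_pos.trans_le (hm ⊥ (by
    intro x hx y hy
    rw [Subgroup.mem_bot.1 hx, Subgroup.mem_bot.1 hy]))
  rw [← Nat.prod_factorization_pow_eq_self (n := Nat.card G) Nat.card_pos.ne']
  refine (Finset.prod_le_pow_card _ _ (m ^ (m + 1)) fun p hp => ?_).trans
    (Nat.pow_le_pow_right (pow_pos hmpos _) ?_)
  · have : Fact p.Prime := ⟨Nat.prime_of_mem_primeFactors hp⟩
    obtain ⟨P⟩ : Nonempty (Sylow p G) := inferInstance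
    change p ^ (Nat.card G).factorization p ≤ _
    rw [← P.card_eq_multiplicity]
    refine P.isPGroup'.card_le_pow fun A hA => ?_
    rw [Nat.card_congr (A.equivMapOfInjective P.1.subtype P.1.subtype_injective).toEquiv]
    refine hm _ ?_
    rintro _ ⟨x, hx, rfl⟩ _ ⟨y, hy, rfl⟩
    rw [← map_mul, ← map_mul, hA x hx y hy]
  · rw [Nat.support_factorization]
    have hsub : (Nat.card G).primeFactors ⊆ Finset.Icc 1 m := by
      intro p hp
      have : Fact p.Prime := ⟨Nat.prime_of_mem_primeFactors hp⟩
      obtain ⟨x, hx⟩ := exists_prime_orderOf_dvd_card' (G := G) p (Nat.dvd_of_mem_primeFactors hp)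
      refine Finset.mem_Icc.2 ⟨this.out.one_le, ?_⟩
      rw [← hx, ← Nat.card_zpowers]
      refine hm _ ?_
      rintro _ ⟨i, rfl⟩ _ ⟨j, rfl⟩
      exact zpow_mul_comm x i j
    simpa using Finset.card_le_card hsub

theorem card_lt_of_graphGenus_commutingGraph_eq [Finite G] {g : ℕ} (hG : ∃ a b : G, a * b ≠ b * a)
    (hg : graphGenus (commutingGraph G) = g) :
    Nat.card G < (2 * heawoodNumber g) ^ (heawoodNumber g * (4 * heawoodNumber g + 1) ^ 2) := by
  have h4 := four_le_heawoodNumber g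
  refine (card_le_pow_of_card_commutative_le
    (card_le_two_mul_heawoodNumber hG hg)).trans_lt ?_
  rw [← pow_mul]
  refine Nat.pow_lt_pow_right (by omega) ?_
  nlinarith

end Groups

/-- There are only finitely many group structures on `Fin n`, and every group of order `n` is
isomorphic to one of them. -/
theorem exists_finite_family_of_card_lt (N : ℕ) : ∃ (k : ℕ) (H : Fin k → GrpCat.{0}),
    ∀ (G : Type*) [Group G] [Finite G], Nat.card G < N → ∃ i : Fin k, Nonempty (G ≃* H i) := by
  have hfin : ∀ n : ℕ, Finite (Group (Fin n)) := fun n =>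
    Finite.of_injective (fun (S : Group (Fin n)) => S.mul) fun S T h => by
      apply Group.ext
      exact h
  let I := Σ n : Fin N, Group (Fin n)
  obtain ⟨k, ⟨e⟩⟩ := Finite.exists_equiv_fin I
  refine ⟨k, fun i => @GrpCat.of (Fin (e.symm i).1) (e.symm i).2, fun G _ _ hG => ?_⟩
  let f : Fin (Nat.card G) ≃ G := (Finite.equivFin G).symm
  let S : Group (Fin (Nat.card G)) := f.group
  let x : I := ⟨⟨Nat.card G, hG⟩, S⟩
  refine ⟨e x, ?_⟩
  beta_reduce
  rw [e.symm_apply_apply]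
  exact ⟨@MulEquiv.symm _ _ f.mul _ f.mulEquiv⟩

/-! ### The order of a group whose commuting graph has given genus -/

theorem theorem3p3 :
    (∀ (G : Type u) [Group G] [Finite G] (g : ℕ), (∃ a b : G, a * b ≠ b * a) →
      graphGenus (commutingGraph G) = (g : ℕ∞) →
      Nat.card G <
        (2 * heawoodNumber g) ^ (heawoodNumber g * (4 * heawoodNumber g + 1) ^ 2)) ∧
    (∀ g : ℕ, ∃ (k : ℕ) (H : Fin k → GrpCat.{0}),
      ∀ (G : Type u) [Group G] [Finite G], (∃ a b : G, a * b ≠ b * a) →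
        graphGenus (commutingGraph G) = (g : ℕ∞) → ∃ i : Fin k, Nonempty (G ≃* H i)) := by
  refine ⟨fun G _ _ g hG hg => card_lt_of_graphGenus_commutingGraph_eq hG hg, fun g => ?_⟩
  obtain ⟨k, H, hH⟩ := exists_finite_family_of_card_lt
    ((2 * heawoodNumber g) ^ (heawoodNumber g * (4 * heawoodNumber g + 1) ^ 2))
  exact ⟨k, H, fun G _ _ hG hg => hH G (card_lt_of_graphGenus_commutingGraph_eq hG hg)⟩
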